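/- **Definitions.** A *Markov category* is a symmetric monoidal category $\mathcal{C}$ whose unit $I$ is terminal and in which every object $X$ carries a distinguished morphism $\mathrm{copy}_X : X \to X \otimes X$ making it, together with the unique morphism $X \to I$, a commutative comonoid, compatibly with $\otimes$: $\mathrm{copy}_{X \otimes Y}$ is $\mathrm{copy}_X \otimes \mathrm{copy}_Y$ followed by the swap of the two middle factors. A morphism $f : X \to Y$ is *deterministic* if $\mathrm{copy}_Y \circ f = (f \otimes f) \circ \mathrm{copy}_X$. The deterministic morphisms form a wide subcategory $\mathcal{C}_{\det}$, which is cartesian monoidal for the structure inherited from $\mathcal{C}$, the diagonals being the copy maps. A *distribution object* for $X$ is an object $PX$ with a morphism $\mathrm{samp} : PX \to X$ such that $f \mapsto \mathrm{samp} \circ f$ is a bijection $\mathcal{C}_{\det}(A, PX) \to \mathcal{C}(A, X)$ for every object $A$. The Markov category $\mathcal{C}$ is *representable* if every object has a distribution object. A *symmetric monoidal monad* on a cartesian monoidal category $\mathcal{D}$ is a monad $(P, E, \delta)$ whose functor is symmetric lax monoidal, with structure maps $\nabla : PX \times PY \to P(X \times Y)$, and whose multiplication $E$ and unit $\delta$ are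 monoidal transformations; it is *affine* if $P(1) \cong 1$. For such an affine $P$, the Kleisli category $\mathrm{Kl}(P)$ is a Markov category: on objects the tensor product is the product of $\mathcal{D}$, the tensor product of the Kleisli morphisms represented by $f : A \to PX$ and $g : B \to PY$ is represented by $\nabla \circ (f \times g)$, and the structure isomorphisms and copy maps are the images of those isomorphisms and of the diagonals of $\mathcal{D}$ under the canonical functor $\mathcal{D} \to \mathrm{Kl}(P)$. An *isomorphism of Markov categories* is an isomorphism of categories that is a strict symmetric monoidal functor and preserves the copy maps. **Theorem.** For a Markov category $\mathcal{C}$, the following are equivalent: 1. $\mathcal{C}$ is representable. 2. There is an affine symmetric monoidal monad $(P, E, \delta)$ on $\mathcal{C}_{\det}$ such that - for every object $X$, the square in $\mathcal{C}_{\det}$ with sides $\delta : X \to PX$, $(\delta, \delta) : X \to PX \times PX$, $P(\mathrm{id}, \mathrm{id}) : PX \to P(X \times X)$ and $\nabla : PX \times PX \to P(X \times X)$ is a pullback, and - the identity functor on $\mathcal{C}_{\det}$ extends to an isomorphism of Markov categories $\Phi : \mathcal{C} \cong \mathrm{Kl}(P)$; that is, $\Phi$ composed with the inclusion $\mathcal{C}_{\det}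 \hookrightarrow \mathcal{C}$ is the canonical functor $\mathcal{C}_{\det} \to \mathrm{Kl}(P)$. -/

import Mathlib

universe v u

namespace CategoryTheory

open MonoidalCategory ComonObj Limits

theorem tensorμ_braiding {C : Type u} [Category.{v} C] [MonoidalCategory C] [SymmetricCategory C]
    (X Y : C) :
    (β_ (X ⊗ X) (Y ⊗ Y)).hom ≫ tensorμ Y Y X X =
      tensorμ X X Y Y ≫ ((β_ X Y).hom ⊗ₘ (β_ X Y).hom) := by
  simp only [tensorμ, Category.assoc,
    BraidedCategory.braiding_tensor_right_hom, BraidedCategory.braiding_tensor_left_hom,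
    comp_whiskerRight, whisker_assoc, MonoidalCategory.whiskerLeft_comp, pentagon_assoc,
    pentagon_inv_hom_hom_hom_inv_assoc, Iso.inv_hom_id_assoc, whiskerLeft_hom_inv_assoc]
  have h : Y ◁ (β_ X Y).hom ▷ X ≫ Y ◁ (β_ Y X).hom ▷ X = 𝟙 _ := by
    rw [← MonoidalCategory.whiskerLeft_comp, ← comp_whiskerRight, SymmetricCategory.symmetry]
    simp
  rw [reassoc_of% h, MonoidalCategory.tensorHom_def]
  simp

theorem tensorμ_tensorμ {C : Type u} [Category.{v} C] [MonoidalCategory C] [SymmetricCategory C]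
    (X₁ X₂ Y₁ Y₂ : C) :
    tensorμ X₁ X₂ Y₁ Y₂ ≫ tensorμ X₁ Y₁ X₂ Y₂ = 𝟙 _ := by
  rw [← tensorμ_tensorδ]
  simp [tensorμ, tensorδ, SymmetricCategory.braiding_swap_eq_inv_braiding]

section Deterministic

variable {C : Type u} [Category.{v} C] [MonoidalCategory C] [MarkovCategory C]

variable (C) in
/-- The class of deterministic morphisms of a Markov category. -/
def deterministic : MorphismProperty C := fun _ _ f => Deterministic f

theorem deterministic_iff {X Y : C} (f : X ⟶ Y) :
    deterministic C f ↔ f ≫ Δ[Y] = Δ[X] ≫ (f ⊗ₘ f) :=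
  ⟨fun h => h.hom_comul, fun h => ⟨MarkovCategory.discard_natural f, h⟩⟩

theorem deterministic_inv {X Y : C} (e : X ≅ Y) (h : deterministic C e.hom) :
    deterministic C e.inv :=
  haveI : IsComonHom e.hom := h
  (inferInstance : IsComonHom e.inv)

instance : (deterministic C).IsMultiplicative where
  id_mem X := (inferInstance : IsComonHom (𝟙 X))
  comp_mem f g hf hg :=
    haveI : IsComonHom f := hf
    haveI : IsComonHom g := hg
    (inferInstance : IsComonHom (f ≫ g))

theorem deterministic_copy (X : C) : deterministic C Δ[X] := by
  rw [deterministic_iff, CopyDiscardCategory.copy_tensor]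
  have h : Δ[X] ≫ (Δ[X] ⊗ₘ Δ[X]) =
      Δ[X] ≫ X ◁ Δ[X] ≫ X ◁ Δ[X] ▷ X ≫ X ◁ (α_ X X X).hom ≫ (α_ X X (X ⊗ X)).inv := by
    rw [MonoidalCategory.tensorHom_def, ComonObj.comul_assoc_flip_assoc,
      ← associator_inv_naturality_right, ← MonoidalCategory.whiskerLeft_comp_assoc,
      ComonObj.comul_assoc]
    simp
  have hc : X ◁ Δ[X] ▷ X ≫ X ◁ (β_ X X).hom ▷ X = X ◁ Δ[X] ▷ X := by
    rw [← MonoidalCategory.whiskerLeft_comp, ← comp_whiskerRight, IsCommComonObj.comul_comm]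
  rw [reassoc_of% h, h]
  simp [tensorμ, reassoc_of% hc]

theorem deterministic_associator (X Y Z : C) : deterministic C (α_ X Y Z).hom := by
  rw [deterministic_iff]
  simp only [CopyDiscardCategory.copy_tensor]
  have h : (tensorμ X X Y Y ▷ (Z ⊗ Z)) ≫ tensorμ (X ⊗ Y) (X ⊗ Y) Z Z ≫
      ((α_ X Y Z).hom ⊗ₘ (α_ X Y Z).hom) =
      (α_ (X ⊗ X) (Y ⊗ Y) (Z ⊗ Z)).hom ≫ ((X ⊗ X) ◁ tensorμ Y Y Z Z) ≫
        tensorμ X X (Y ⊗ Z) (Y ⊗ Z) := by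
    have h := associator_monoidal X Y Z X Y Z =≫
      ((X ⊗ X) ◁ tensorμ Y Y Z Z ≫ tensorμ X X (Y ⊗ Z) (Y ⊗ Z))
    simp only [Category.assoc, ← MonoidalCategory.whiskerLeft_comp_assoc, tensorμ_tensorμ,
      MonoidalCategory.whiskerLeft_id, Category.id_comp, Category.comp_id] at h
    rw [← h, reassoc_of% tensorμ_tensorμ, ← comp_whiskerRight_assoc, tensorμ_tensorμ]
    simp
  have e₁ : ((Δ[X] ⊗ₘ Δ[Y]) ≫ tensorμ X X Y Y) ⊗ₘ Δ[Z] =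
      ((Δ[X] ⊗ₘ Δ[Y]) ⊗ₘ Δ[Z]) ≫ tensorμ X X Y Y ▷ (Z ⊗ Z) := by
    rw [← tensorHom_id, tensorHom_comp_tensorHom, Category.comp_id]
  have e₂ : Δ[X] ⊗ₘ ((Δ[Y] ⊗ₘ Δ[Z]) ≫ tensorμ Y Y Z Z) =
      (Δ[X] ⊗ₘ (Δ[Y] ⊗ₘ Δ[Z])) ≫ (X ⊗ X) ◁ tensorμ Y Y Z Z := by
    rw [← id_tensorHom, tensorHom_comp_tensorHom, Category.comp_id]
  rw [e₁, e₂]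
  simp only [Category.assoc, h]
  rw [associator_naturality_assoc]

theorem deterministic_leftUnitor (X : C) : deterministic C (λ_ X).hom := by
  rw [deterministic_iff]
  simp only [CopyDiscardCategory.copy_tensor, CopyDiscardCategory.copy_unit]
  rw [leftUnitor_monoidal, Category.assoc, reassoc_of% tensorμ_tensorμ, MonoidalCategory.tensorHom_def']
  simp

theorem deterministic_rightUnitor (X : C) : deterministic C (ρ_ X).hom := by
  rw [deterministic_iff]
  simp only [CopyDiscardCategory.copy_tensor, CopyDiscardCategory.copy_unit]
  rw [rightUnitor_monoidal, Category.assoc, reassoc_of% tensorμ_tensorμ, MonoidalCategory.tensorHom_def]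
  simp

theorem deterministic_braiding (X Y : C) : deterministic C (β_ X Y).hom := by
  rw [deterministic_iff]
  simp only [CopyDiscardCategory.copy_tensor, Category.assoc]
  rw [← tensorμ_braiding, BraidedCategory.braiding_naturality_assoc]

instance : (deterministic C).IsMonoidal :=
  .mk' _ fun {X₁ X₂ Y₁ Y₂} f g hf hg => by
    rw [deterministic_iff] at hf hg ⊢
    simp only [CopyDiscardCategory.copy_tensor, Category.assoc, ← tensorμ_natural,
      tensorHom_comp_tensorHom_assoc, hf, hg]


instance : (deterministic C).IsMonoidalStable where
  associator_hom_mem := deterministic_associator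
  associator_inv_mem X Y Z := deterministic_inv _ (deterministic_associator X Y Z)
  leftUnitor_hom_mem := deterministic_leftUnitor
  leftUnitor_inv_mem X := deterministic_inv _ (deterministic_leftUnitor X)
  rightUnitor_hom_mem := deterministic_rightUnitor
  rightUnitor_inv_mem X := deterministic_inv _ (deterministic_rightUnitor X)

instance : (deterministic C).IsStableUnderBraiding where
  braiding_hom_mem := deterministic_braiding
  braiding_inv_mem X Y := deterministic_inv _ (deterministic_braiding X Y)

variable (C) in
/-- The subcategory `C_det` of deterministic morphisms of a Markov category, with the symmetric
monoidal structure inherited from `C`. -/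
abbrev Det := WideSubcategory (deterministic C)

variable (C) in
/-- The inclusion functor of `C_det` into `C`. -/
abbrev Det.incl : Det C ⥤ C := wideSubcategoryInclusion (deterministic C)

theorem deterministic_discard (X : C) : deterministic C ε[X] := by
  rw [deterministic_iff, CopyDiscardCategory.copy_unit, ← cancel_mono (λ_ (𝟙_ C)).hom]
  exact MarkovCategory.isTerminalUnit.hom_ext _ _

theorem copy_fst {T X Y : C} (f : T ⟶ X) (g : T ⟶ Y) :
    (Δ[T] ≫ (f ⊗ₘ g)) ≫ X ◁ ε[Y] ≫ (ρ_ X).hom = f := by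
  rw [← id_tensorHom, Category.assoc, tensorHom_comp_tensorHom_assoc, Category.comp_id,
    MarkovCategory.discard_natural, MonoidalCategory.tensorHom_def', Category.assoc,
    ComonObj.comul_counit_assoc]
  simp

theorem copy_snd {T X Y : C} (f : T ⟶ X) (g : T ⟶ Y) :
    (Δ[T] ≫ (f ⊗ₘ g)) ≫ ε[X] ▷ Y ≫ (λ_ Y).hom = g := by
  rw [← tensorHom_id, Category.assoc, tensorHom_comp_tensorHom_assoc, Category.comp_id,
    MarkovCategory.discard_natural, MonoidalCategory.tensorHom_def, Category.assoc,
    ComonObj.counit_comul_assoc]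
  simp

theorem copy_fst_snd (X Y : C) :
    ((Δ[X] ⊗ₘ Δ[Y]) ≫ tensorμ X X Y Y) ≫
      ((X ◁ ε[Y] ≫ (ρ_ X).hom) ⊗ₘ (ε[X] ▷ Y ≫ (λ_ Y).hom)) = 𝟙 (X ⊗ Y) := by
  have h₀ : tensorμ X (𝟙_ C) (𝟙_ C) Y ≫ ((ρ_ X).hom ⊗ₘ (λ_ Y).hom) =
      (ρ_ X).hom ⊗ₘ (λ_ Y).hom := by
    have : (β_ (𝟙_ C) (𝟙_ C)).hom = 𝟙 _ := by
      rw [← cancel_mono (λ_ (𝟙_ C)).hom]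
      exact MarkovCategory.isTerminalUnit.hom_ext _ _
    rw [tensorμ, this]
    monoidal
  have h : tensorμ X X Y Y ≫ ((X ◁ ε[Y] ≫ (ρ_ X).hom) ⊗ₘ (ε[X] ▷ Y ≫ (λ_ Y).hom)) =
      ((X ◁ ε[X] ≫ (ρ_ X).hom) ⊗ₘ (ε[Y] ▷ Y ≫ (λ_ Y).hom)) := by
    rw [← tensorHom_comp_tensorHom, ← id_tensorHom, ← tensorHom_id, ← tensorμ_natural_assoc, h₀,
      tensorHom_comp_tensorHom, id_tensorHom, tensorHom_id]
  rw [Category.assoc, h, tensorHom_comp_tensorHom]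
  simp

theorem Det.eq_lift {T : C} {X Y : C} (m : T ⟶ X ⊗ Y) (hm : deterministic C m) :
    m = Δ[T] ≫ ((m ≫ X ◁ ε[Y] ≫ (ρ_ X).hom) ⊗ₘ (m ≫ ε[X] ▷ Y ≫ (λ_ Y).hom)) := by
  rw [← tensorHom_comp_tensorHom, ← Category.assoc, ← (deterministic_iff m).1 hm,
    CopyDiscardCategory.copy_tensor, Category.assoc, copy_fst_snd, Category.comp_id]

/-- `C_det` is cartesian monoidal: the pairing of `f` and `g` is copying followed by `f ⊗ g`. -/
instance Det.cartesianMonoidalCategory : CartesianMonoidalCategory (Det C) where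
  isTerminalTensorUnit := IsTerminal.ofUniqueHom (fun X => ⟨ε[X.obj], deterministic_discard X.obj⟩)
    fun X f => by ext; exact MarkovCategory.isTerminalUnit.hom_ext _ _
  fst X Y := X ◁ (⟨ε[Y.obj], deterministic_discard Y.obj⟩ : Y ⟶ 𝟙_ (Det C)) ≫ (ρ_ X).hom
  snd X Y := (⟨ε[X.obj], deterministic_discard X.obj⟩ : X ⟶ 𝟙_ (Det C)) ▷ Y ≫ (λ_ Y).hom
  fst_def _ _ := rfl
  snd_def _ _ := rfl
  tensorProductIsBinaryProduct X Y := BinaryFan.IsLimit.mk _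
    (fun {T} f g => (⟨Δ[T.obj], deterministic_copy T.obj⟩ : T ⟶ T ⊗ T) ≫ (f ⊗ₘ g))
    (fun {T} f g => by
      ext
      exact copy_fst f.hom g.hom)
    (fun {T} f g => by
      ext
      exact copy_snd f.hom g.hom)
    (fun {T} f g m h₁ h₂ => by
      ext
      subst h₁ h₂
      exact Det.eq_lift m.hom m.property)

end Deterministic

section Kleisli

open CartesianMonoidalCategory

variable {D : Type u} [Category.{v} D]

/-- A symmetric monoidal monad: a monad whose underlying functor is symmetric lax monoidal and
whose unit and multiplication are monoidal natural transformations. -/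
class Monad.SymmetricMonoidal [MonoidalCategory D] [BraidedCategory D] (T : Monad D) where
  laxBraided : T.toFunctor.LaxBraided
  isMonoidal_η : NatTrans.IsMonoidal T.η
  isMonoidal_μ : NatTrans.IsMonoidal T.μ

attribute [reducible] Monad.SymmetricMonoidal.laxBraided
attribute [instance] Monad.SymmetricMonoidal.laxBraided Monad.SymmetricMonoidal.isMonoidal_η
  Monad.SymmetricMonoidal.isMonoidal_μ

/-- The structure maps `∇ : T X ⊗ T Y ⟶ T (X ⊗ Y)` of a symmetric monoidal monad. -/
abbrev Monad.nabla [MonoidalCategory D] [BraidedCategory D] (T : Monad D) [T.SymmetricMonoidal]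
    (X Y : D) : T.obj X ⊗ T.obj Y ⟶ T.obj (X ⊗ Y) :=
  Functor.LaxMonoidal.μ T.toFunctor X Y

/-- A monad on a cartesian monoidal category is affine if it preserves the terminal object. -/
class Monad.Affine [CartesianMonoidalCategory D] (T : Monad D) : Prop where
  nonempty_iso : Nonempty (T.obj (𝟙_ D) ≅ 𝟙_ D)

namespace Kleisli

variable {T : Monad D}

theorem id_eq_toKleisli (X : Kleisli T) : 𝟙 X = (Adjunction.toKleisli T).map (𝟙 X.of) :=
  ((Adjunction.toKleisli T).map_id X.of).symm

theorem comp_toKleisli_of {A B : Kleisli T} {Y : D} (f : A ⟶ B) (g : B.of ⟶ Y) :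
    (f ≫ (Adjunction.toKleisli T).map g : A ⟶ Kleisli.mk T Y).of = f.of ≫ T.map g := by
  change f.of ≫ T.map (g ≫ T.η.app Y) ≫ T.μ.app Y = _
  simp

theorem toKleisli_comp_of {A : D} {B X : Kleisli T} (g : A ⟶ B.of) (f : B ⟶ X) :
    ((Adjunction.toKleisli T).map g ≫ f : Kleisli.mk T A ⟶ X).of = g ≫ f.of := by
  change (g ≫ T.η.app B.of) ≫ T.map f.of ≫ T.μ.app X.of = _
  have := T.η.naturality_assoc f.of (T.μ.app X.of)
  simp at this
  simp [← this]

section Monoidal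

variable [MonoidalCategory D] [BraidedCategory D] (T) [T.SymmetricMonoidal]

theorem η_nabla (X Y : D) :
    (T.η.app X ⊗ₘ T.η.app Y) ≫ T.nabla X Y = T.η.app (X ⊗ Y) := by
  have := NatTrans.IsMonoidal.tensor (τ := T.η) X Y
  simpa using this.symm

theorem μ_nabla (X Y : D) :
    (T.μ.app X ⊗ₘ T.μ.app Y) ≫ T.nabla X Y =
      T.nabla (T.obj X) (T.obj Y) ≫ T.map (T.nabla X Y) ≫ T.μ.app (X ⊗ Y) := by
  have := NatTrans.IsMonoidal.tensor (τ := T.μ) X Y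
  simpa using this.symm

theorem nabla_natural {X X' Y Y' : D} (f : X ⟶ X') (g : Y ⟶ Y') :
    (T.map f ⊗ₘ T.map g) ≫ T.nabla X' Y' = T.nabla X Y ≫ T.map (f ⊗ₘ g) :=
  Functor.LaxMonoidal.μ_natural T.toFunctor f g

theorem ε_eq : Functor.LaxMonoidal.ε T.toFunctor = T.η.app (𝟙_ D) := by
  have := NatTrans.IsMonoidal.unit (τ := T.η)
  simpa using this.symm

variable {T}

/-- The tensor product of Kleisli morphisms represented by `f : A ⟶ T X` and `g : B ⟶ T Y` is
represented by `(f ⊗ g) ≫ ∇`. -/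
def tensorHom {A X B Y : Kleisli T} (f : A ⟶ X) (g : B ⟶ Y) :
    Kleisli.mk T (A.of ⊗ B.of) ⟶ Kleisli.mk T (X.of ⊗ Y.of) :=
  .mk ((f.of ⊗ₘ g.of) ≫ T.nabla X.of Y.of)

/-- The tensor product on `Kl(T)` is that of `D` on objects, and its structure isomorphisms are the
images of those of `D`. -/
instance : MonoidalCategoryStruct (Kleisli T) where
  tensorObj X Y := .mk T (X.of ⊗ Y.of)
  tensorHom f g := tensorHom f g
  whiskerLeft X _ _ f := tensorHom (𝟙 X) f
  whiskerRight f Y := tensorHom f (𝟙 Y)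
  tensorUnit := .mk T (𝟙_ D)
  associator X Y Z := (Adjunction.toKleisli T).mapIso (α_ X.of Y.of Z.of)
  leftUnitor X := (Adjunction.toKleisli T).mapIso (λ_ X.of)
  rightUnitor X := (Adjunction.toKleisli T).mapIso (ρ_ X.of)

theorem tensorHom_of {A X B Y : Kleisli T} (f : A ⟶ X) (g : B ⟶ Y) :
    (f ⊗ₘ g).of = (f.of ⊗ₘ g.of) ≫ T.nabla X.of Y.of := rfl

theorem tensor_toKleisli {A X B Y : D} (f : A ⟶ X) (g : B ⟶ Y) :
    (Adjunction.toKleisli T).map f ⊗ₘ (Adjunction.toKleisli T).map g =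
      (Adjunction.toKleisli T).map (f ⊗ₘ g) := by
  ext
  change ((f ≫ T.η.app X) ⊗ₘ (g ≫ T.η.app Y)) ≫ T.nabla X Y = (f ⊗ₘ g) ≫ T.η.app (X ⊗ Y)
  rw [← tensorHom_comp_tensorHom, Category.assoc, η_nabla]

instance : MonoidalCategory (Kleisli T) := .ofTensorHom
  (id_tensorHom_id := fun X Y => by
    ext
    exact η_nabla T X.of Y.of)
  (id_tensorHom := fun _ _ _ _ => rfl)
  (tensorHom_id := fun _ _ => rfl)
  (tensorHom_comp_tensorHom := fun {X₁ Y₁ Z₁ X₂ Y₂ Z₂} f₁ f₂ g₁ g₂ => by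
    ext
    change ((f₁.of ⊗ₘ f₂.of) ≫ T.nabla Y₁.of Y₂.of) ≫
      T.map ((g₁.of ⊗ₘ g₂.of) ≫ T.nabla Z₁.of Z₂.of) ≫ T.μ.app (Z₁.of ⊗ Z₂.of) =
      ((f₁.of ≫ T.map g₁.of ≫ T.μ.app Z₁.of) ⊗ₘ (f₂.of ≫ T.map g₂.of ≫ T.μ.app Z₂.of)) ≫
        T.nabla Z₁.of Z₂.of
    rw [← tensorHom_comp_tensorHom, ← tensorHom_comp_tensorHom, Category.assoc, Category.assoc,
      Category.assoc, μ_nabla, reassoc_of% nabla_natural, Functor.map_comp, Category.assoc])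
  (associator_naturality := fun {X₁ X₂ X₃ Y₁ Y₂ Y₃} f₁ f₂ f₃ => by
    ext
    refine (comp_toKleisli_of _ _).trans (.trans ?_ (toKleisli_comp_of _ _).symm)
    change ((((f₁.of ⊗ₘ f₂.of) ≫ T.nabla _ _) ⊗ₘ f₃.of) ≫ T.nabla _ _) ≫ T.map _ =
      _ ≫ (f₁.of ⊗ₘ ((f₂.of ⊗ₘ f₃.of) ≫ T.nabla _ _)) ≫ T.nabla _ _
    have e₁ : ((f₁.of ⊗ₘ f₂.of) ≫ T.nabla Y₁.of Y₂.of) ⊗ₘ f₃.of =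
        ((f₁.of ⊗ₘ f₂.of) ⊗ₘ f₃.of) ≫ T.nabla Y₁.of Y₂.of ▷ T.obj Y₃.of := by
      rw [← MonoidalCategory.tensorHom_id, tensorHom_comp_tensorHom, Category.comp_id]
    have e₂ : f₁.of ⊗ₘ ((f₂.of ⊗ₘ f₃.of) ≫ T.nabla Y₂.of Y₃.of) =
        (f₁.of ⊗ₘ (f₂.of ⊗ₘ f₃.of)) ≫ T.obj Y₁.of ◁ T.nabla Y₂.of Y₃.of := by
      rw [← MonoidalCategory.id_tensorHom, tensorHom_comp_tensorHom, Category.comp_id]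
    rw [e₁, e₂, Category.assoc, Category.assoc, Category.assoc,
      Functor.LaxMonoidal.associativity, MonoidalCategory.associator_naturality_assoc])
  (leftUnitor_naturality := fun {X Y} f => by
    ext
    refine (comp_toKleisli_of _ _).trans (.trans ?_ (toKleisli_comp_of _ _).symm)
    change ((T.η.app (𝟙_ D) ⊗ₘ f.of) ≫ T.nabla _ _) ≫ T.map (λ_ Y.of).hom = (λ_ X.of).hom ≫ f.of
    rw [← ε_eq, MonoidalCategory.tensorHom_def', Category.assoc, Category.assoc,
      ← Functor.LaxMonoidal.left_unitality]
    exact MonoidalCategory.leftUnitor_naturality f.of)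
  (rightUnitor_naturality := fun {X Y} f => by
    ext
    refine (comp_toKleisli_of _ _).trans (.trans ?_ (toKleisli_comp_of _ _).symm)
    change ((f.of ⊗ₘ T.η.app (𝟙_ D)) ≫ T.nabla _ _) ≫ T.map (ρ_ Y.of).hom = (ρ_ X.of).hom ≫ f.of
    rw [← ε_eq, MonoidalCategory.tensorHom_def, Category.assoc, Category.assoc,
      ← Functor.LaxMonoidal.right_unitality]
    exact MonoidalCategory.rightUnitor_naturality f.of)
  (pentagon := fun W X Y Z => by
    rw [id_eq_toKleisli Z, id_eq_toKleisli W]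
    have := congrArg (Adjunction.toKleisli T).map (MonoidalCategory.pentagon W.of X.of Y.of Z.of)
    simp only [Functor.map_comp, ← MonoidalCategory.tensorHom_id,
      ← MonoidalCategory.id_tensorHom, ← tensor_toKleisli] at this
    exact this)
  (triangle := fun X Y => by
    rw [id_eq_toKleisli X, id_eq_toKleisli Y]
    have := congrArg (Adjunction.toKleisli T).map (MonoidalCategory.triangle X.of Y.of)
    simp only [Functor.map_comp, ← MonoidalCategory.tensorHom_id,
      ← MonoidalCategory.id_tensorHom, ← tensor_toKleisli] at this
    exact this)

theorem whiskerLeft_toKleisli (X : D) {A B : D} (f : A ⟶ B) :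
    Kleisli.mk T X ◁ (Adjunction.toKleisli T).map f = (Adjunction.toKleisli T).map (X ◁ f) := by
  rw [← MonoidalCategory.id_tensorHom, ← MonoidalCategory.id_tensorHom, ← tensor_toKleisli,
    id_eq_toKleisli]
  rfl

theorem toKleisli_whiskerRight {A B : D} (f : A ⟶ B) (X : D) :
    (Adjunction.toKleisli T).map f ▷ Kleisli.mk T X = (Adjunction.toKleisli T).map (f ▷ X) := by
  rw [← MonoidalCategory.tensorHom_id, ← MonoidalCategory.tensorHom_id, ← tensor_toKleisli,
    id_eq_toKleisli]
  rfl

end Monoidal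

section Symmetric

variable [MonoidalCategory D] [SymmetricCategory D] [T.SymmetricMonoidal]

/-- The symmetry of `Kl(T)` is the image of the symmetry of `D`. -/
instance : SymmetricCategory (Kleisli T) where
  braiding X Y := (Adjunction.toKleisli T).mapIso (β_ X.of Y.of)
  braiding_naturality_right X {Y Z} f := by
    ext
    refine (comp_toKleisli_of _ _).trans (.trans ?_ (toKleisli_comp_of _ _).symm)
    change ((T.η.app X.of ⊗ₘ f.of) ≫ T.nabla _ _) ≫ T.map (β_ X.of Z.of).hom =
      _ ≫ (f.of ⊗ₘ T.η.app X.of) ≫ T.nabla _ _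
    rw [Category.assoc, Functor.LaxBraided.braided, BraidedCategory.braiding_naturality_assoc]
    rfl
  braiding_naturality_left {Y Z} f X := by
    ext
    refine (comp_toKleisli_of _ _).trans (.trans ?_ (toKleisli_comp_of _ _).symm)
    change ((f.of ⊗ₘ T.η.app X.of) ≫ T.nabla _ _) ≫ T.map (β_ Z.of X.of).hom =
      _ ≫ (T.η.app X.of ⊗ₘ f.of) ≫ T.nabla _ _
    rw [Category.assoc, Functor.LaxBraided.braided, BraidedCategory.braiding_naturality_assoc]
    rfl
  hexagon_forward X Y Z := by
    have := congrArg (Adjunction.toKleisli T).map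
      (BraidedCategory.hexagon_forward X.of Y.of Z.of)
    simp only [Functor.map_comp, ← whiskerLeft_toKleisli, ← toKleisli_whiskerRight] at this
    exact this
  hexagon_reverse X Y Z := by
    have := congrArg (Adjunction.toKleisli T).map
      (BraidedCategory.hexagon_reverse X.of Y.of Z.of)
    simp only [Functor.map_comp, ← whiskerLeft_toKleisli, ← toKleisli_whiskerRight] at this
    exact this
  symmetry X Y := by
    have := congrArg (Adjunction.toKleisli T).map (SymmetricCategory.symmetry X.of Y.of)
    simp only [Functor.map_comp, Functor.map_id] at this
    exact this

theorem toKleisli_tensorμ (X₁ X₂ Y₁ Y₂ : D) :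
    tensorμ (Kleisli.mk T X₁) (Kleisli.mk T X₂) (Kleisli.mk T Y₁) (Kleisli.mk T Y₂) =
      (Adjunction.toKleisli T).map (tensorμ X₁ X₂ Y₁ Y₂) := by
  simp only [tensorμ, Functor.map_comp, ← whiskerLeft_toKleisli, ← toKleisli_whiskerRight]
  rfl

end Symmetric

section Markov

variable [CartesianMonoidalCategory D] [SymmetricCategory D] [T.SymmetricMonoidal]

/-- Copying in `Kl(T)` is the image of the diagonal of `D`, and discarding is the image of the
map to the terminal object. -/
abbrev comonObj (X : Kleisli T) : ComonObj X where
  counit := (Adjunction.toKleisli T).map (toUnit X.of)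
  comul := (Adjunction.toKleisli T).map (lift (𝟙 X.of) (𝟙 X.of))
  counit_comul := by
    have : lift (𝟙 X.of) (𝟙 X.of) ≫ toUnit X.of ▷ X.of = (λ_ X.of).inv := by
      ext; simp
    have := congrArg (Adjunction.toKleisli T).map this
    simp only [Functor.map_comp, ← toKleisli_whiskerRight] at this
    exact this
  comul_counit := by
    have : lift (𝟙 X.of) (𝟙 X.of) ≫ X.of ◁ toUnit X.of = (ρ_ X.of).inv := by
      ext; simp
    have := congrArg (Adjunction.toKleisli T).map this
    simp only [Functor.map_comp, ← whiskerLeft_toKleisli] at this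
    exact this
  comul_assoc := by
    have : lift (𝟙 X.of) (𝟙 X.of) ≫ X.of ◁ lift (𝟙 X.of) (𝟙 X.of) =
        lift (𝟙 X.of) (𝟙 X.of) ≫ lift (𝟙 X.of) (𝟙 X.of) ▷ X.of ≫ (α_ X.of X.of X.of).hom := by
      ext <;> simp
    have := congrArg (Adjunction.toKleisli T).map this
    simp only [Functor.map_comp, ← whiskerLeft_toKleisli, ← toKleisli_whiskerRight] at this
    exact this

/-- `Kl(T)` is a Markov category for an affine symmetric monoidal monad `T` on a cartesian
monoidal category. -/
instance markovCategory [T.Affine] : MarkovCategory (Kleisli T) where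
  comonObj := comonObj
  isCommComonObj X := @IsCommComonObj.mk _ _ _ _ _ (comonObj X) (by
    have : lift (𝟙 X.of) (𝟙 X.of) ≫ (β_ X.of X.of).hom = lift (𝟙 X.of) (𝟙 X.of) := by
      ext <;> simp
    have := congrArg (Adjunction.toKleisli T).map this
    simp only [Functor.map_comp] at this
    exact this)
  copy_tensor X Y := by
    have : lift (𝟙 (X.of ⊗ Y.of)) (𝟙 (X.of ⊗ Y.of)) =
        (lift (𝟙 X.of) (𝟙 X.of) ⊗ₘ lift (𝟙 Y.of) (𝟙 Y.of)) ≫ tensorμ X.of X.of Y.of Y.of := by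
      ext <;> simp [tensorμ]
    have := congrArg (Adjunction.toKleisli T).map this
    simp only [Functor.map_comp, ← tensor_toKleisli, ← toKleisli_tensorμ] at this
    exact this
  discard_tensor X Y := by
    have : toUnit (X.of ⊗ Y.of) = (toUnit X.of ⊗ₘ toUnit Y.of) ≫ (λ_ (𝟙_ D)).hom :=
      toUnit_unique _ _
    have := congrArg (Adjunction.toKleisli T).map this
    simp only [Functor.map_comp, ← tensor_toKleisli] at this
    exact this
  copy_unit := by
    have : lift (𝟙 (𝟙_ D)) (𝟙 (𝟙_ D)) = (λ_ (𝟙_ D)).inv := by ext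
    exact congrArg (Adjunction.toKleisli T).map this
  discard_unit := by
    have : toUnit (𝟙_ D) = 𝟙 (𝟙_ D) := toUnit_unique _ _
    have := congrArg (Adjunction.toKleisli T).map this
    simp only [Functor.map_id] at this
    exact this
  discard_natural f := by
    ext
    obtain ⟨e⟩ := Monad.Affine.nonempty_iso (T := T)
    rw [← cancel_mono e.hom]
    exact toUnit_unique _ _

end Markov

end Kleisli

/-- An isomorphism of Markov categories: a symmetric monoidal isomorphism of categories, strict in
the sense that its coherence maps are identities, which preserves the copy maps. (Discarding is
preserved automatically.) -/
structure MarkovIso (C : Type*) [Category* C] [MonoidalCategory C] [MarkovCategory C]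
    (D : Type*) [Category* D] [MonoidalCategory D] [MarkovCategory D] where
  functor : C ⥤ D
  inverse : D ⥤ C
  functor_inverse : functor ⋙ inverse = 𝟭 C
  inverse_functor : inverse ⋙ functor = 𝟭 D
  braided : functor.Braided
  obj_unit : 𝟙_ D = functor.obj (𝟙_ C)
  obj_tensor (X Y : C) : functor.obj X ⊗ functor.obj Y = functor.obj (X ⊗ Y)
  ε_eq : Functor.LaxMonoidal.ε functor = eqToHom obj_unit
  μ_eq (X Y : C) : Functor.LaxMonoidal.μ functor X Y = eqToHom (obj_tensor X Y)
  map_copy (X : C) : functor.map Δ[X] = Δ[functor.obj X] ≫ Functor.LaxMonoidal.μ functor X X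

/-- A distribution object for `X`: an object `P` with a sampling map `samp : P ⟶ X` such that
composition with `samp` is a bijection from deterministic morphisms `A ⟶ P` to morphisms
`A ⟶ X`, for every `A`. -/
structure DistributionObject {C : Type u} [Category.{v} C] [MonoidalCategory C] [MarkovCategory C]
    (X : C) where
  obj : C
  samp : obj ⟶ X
  bijective (A : Det C) :
    Function.Bijective fun f : A ⟶ (⟨obj⟩ : Det C) => (Det.incl C).map f ≫ samp

/-- A Markov category is representable if every object has a distribution object. -/
def IsRepresentable (C : Type u) [Category.{v} C] [MonoidalCategory C] [MarkovCategory C] : Prop :=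
  ∀ X : C, Nonempty (DistributionObject X)

/-- The square with sides `δ`, `(δ, δ)`, `T (id, id)` and `∇` is a pullback for every object. -/
def Monad.DeltaPullback [CartesianMonoidalCategory D] [BraidedCategory D] (T : Monad D)
    [T.SymmetricMonoidal] : Prop :=
  ∀ X : D, IsPullback (T.η.app X) (lift (T.η.app X) (T.η.app X))
    (T.map (lift (𝟙 X) (𝟙 X))) (T.nabla X X)

end Kleisli

end CategoryTheory

open CategoryTheory

/-! Representability says exactly that the inclusion `C_det ⥤ C` has a right adjoint `P` with counit
`samp`. The inclusion is bijective on objects, so `C` is the Kleisli category of the induced monad: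
a morphism `f : A ⟶ X` of `C` is the same thing as its transpose `sharp f : A ⟶ P X` in `C_det`.
Everything about the monad follows from one principle, `hom_ext`: deterministic maps into `P X`
agree once they agree after `samp`. Under transposition `δ` becomes the identity, `E` becomes
sampling twice, and `∇` becomes `samp ⊗ samp`, so the monad and monoidal laws reduce to identities
in `C`. Affineness is terminality of the unit. In `deltaPullback`, commutativity of a cone says
precisely that the transposed morphism commutes with copying, that is, comes from a map into `X` in
`C_det`. Conversely, the Kleisli adjunction of `P` gives bijections `C_det(A, P X) ≅ Kl(P)(A, X)`,
and an isomorphism `Kl(P) ≅ C` over `C_det` carries them to the universal property of a distribution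
object. -/

namespace CategoryTheory

open MonoidalCategory CartesianMonoidalCategory

section Representable

variable {C : Type u} [Category.{v} C] [MonoidalCategory C] [MarkovCategory C]

/-! ### Passing from morphisms of `C_det` to the underlying morphisms of `C`. -/

namespace Det

/-- The morphism of `C` underlying a morphism of `C_det`. -/
def val {X Y : Det C} (f : X ⟶ Y) : X.obj ⟶ Y.obj := f.hom

/-- A deterministic morphism of `C`, as a morphism of `C_det`. -/
def ofVal {X Y : Det C} (f : X.obj ⟶ Y.obj) (hf : deterministic C f) : X ⟶ Y := ⟨f, hf⟩

theorem val_injective {X Y : Det C} {f g : X ⟶ Y} (h : val f = val g) : f = g :=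
  WideSubcategory.hom_ext _ h

variable {X Y Z W : Det C}

@[simp] theorem val_ofVal (f : X.obj ⟶ Y.obj) (hf : deterministic C f) : val (ofVal f hf) = f := rfl
@[simp] theorem val_id (X : Det C) : val (𝟙 X) = 𝟙 X.obj := rfl
@[simp] theorem val_comp (f : X ⟶ Y) (g : Y ⟶ Z) : val (f ≫ g) = val f ≫ val g := rfl
@[simp] theorem val_tensorHom (f : X ⟶ Y) (g : Z ⟶ W) : val (f ⊗ₘ g) = val f ⊗ₘ val g := rfl
@[simp] theorem val_associator : val (α_ X Y Z).hom = (α_ X.obj Y.obj Z.obj).hom := rfl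
@[simp] theorem val_leftUnitor : val (λ_ X).hom = (λ_ X.obj).hom := rfl
@[simp] theorem val_rightUnitor : val (ρ_ X).hom = (ρ_ X.obj).hom := rfl
@[simp] theorem val_braiding : val (β_ X Y).hom = (β_ X.obj Y.obj).hom := rfl

open ComonObj in
@[simp] theorem val_lift (f : X ⟶ Y) (g : X ⟶ Z) :
    val (lift f g) = Δ[X.obj] ≫ (val f ⊗ₘ val g) := rfl

end Det

open Det

/-! ### The universal property of a distribution object. -/

namespace DistributionObject

variable {X : C} (d : DistributionObject X)

/-- The distribution object, as an object of `C_det`. -/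
abbrev detObj : Det C := ⟨d.obj⟩

/-- The deterministic morphism into the distribution object which corresponds to `f`. -/
noncomputable def sharp {A : Det C} (f : A.obj ⟶ X) : A ⟶ d.detObj :=
  ((d.bijective A).2 f).choose

@[simp]
theorem sharp_samp {A : Det C} (f : A.obj ⟶ X) : val (d.sharp f) ≫ d.samp = f :=
  ((d.bijective A).2 f).choose_spec

@[simp]
theorem sharp_samp_assoc {A : Det C} (f : A.obj ⟶ X) {Z : C} (h : X ⟶ Z) :
    val (d.sharp f) ≫ d.samp ≫ h = f ≫ h := by
  rw [← Category.assoc, sharp_samp]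

theorem hom_ext {A : Det C} {f g : A ⟶ d.detObj} (h : val f ≫ d.samp = val g ≫ d.samp) : f = g :=
  (d.bijective A).1 h

end DistributionObject

/-! ### The monad of distribution objects on `C_det`. -/

variable (d : ∀ X : C, DistributionObject X)

/-- The monad on `C_det` given by a choice of distribution objects. -/
noncomputable def distributionMonad : Monad (Det C) where
  obj X := (d X.obj).detObj
  map {X Y} f := (d Y.obj).sharp ((d X.obj).samp ≫ val f)
  map_id X := (d X.obj).hom_ext (by simp)
  map_comp {X Y Z} f g := (d Z.obj).hom_ext (by simp)
  η :=
    { app X := (d X.obj).sharp (𝟙 X.obj)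
      naturality X Y f := (d Y.obj).hom_ext (by simp) }
  μ :=
    -- Multiplication is the transpose of sampling twice: first a distribution, then a value from
    -- it.
    { app X := (d X.obj).sharp ((d (d X.obj).obj).samp ≫ (d X.obj).samp)
      naturality X Y f := (d Y.obj).hom_ext (by simp) }
  assoc X := (d X.obj).hom_ext (by simp)
  left_unit X := (d X.obj).hom_ext (by simp)
  right_unit X := (d X.obj).hom_ext (by simp)

namespace distributionMonad

/-- The sampling map `P X ⟶ X`. -/
def samp (X : Det C) : ((distributionMonad d).obj X).obj ⟶ X.obj := (d X.obj).samp

/-- The deterministic morphism into `P X` which corresponds to a morphism into `X`. -/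
noncomputable def sharp {A X : Det C} (f : A.obj ⟶ X.obj) : A ⟶ (distributionMonad d).obj X :=
  (d X.obj).sharp f

@[simp]
theorem sharp_samp {A X : Det C} (f : A.obj ⟶ X.obj) : val (sharp d f) ≫ samp d X = f :=
  (d X.obj).sharp_samp f

@[simp]
theorem sharp_samp_assoc {A X : Det C} (f : A.obj ⟶ X.obj) {Z : C} (h : X.obj ⟶ Z) :
    val (sharp d f) ≫ samp d X ≫ h = f ≫ h :=
  (d X.obj).sharp_samp_assoc f h

theorem hom_ext {A X : Det C} {f g : A ⟶ (distributionMonad d).obj X}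
    (h : val f ≫ samp d X = val g ≫ samp d X) : f = g :=
  (d X.obj).hom_ext h

theorem sharp_eq {A X : Det C} (f : A ⟶ (distributionMonad d).obj X) :
    sharp d (val f ≫ samp d X) = f :=
  hom_ext d (by simp)

@[simp]
theorem map_samp {X Y : Det C} (f : X ⟶ Y) :
    val ((distributionMonad d).map f) ≫ samp d Y = samp d X ≫ val f :=
  (d Y.obj).sharp_samp _

@[simp]
theorem map_samp_assoc {X Y : Det C} (f : X ⟶ Y) {Z : C} (h : Y.obj ⟶ Z) :
    val ((distributionMonad d).map f) ≫ samp d Y ≫ h = samp d X ≫ val f ≫ h := by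
  rw [← Category.assoc, map_samp, Category.assoc]

-- The unit is the transpose of the identity. The explicit `X := X` makes the source read `X`
-- instead of `(𝟭 _).obj X`.
@[simp]
theorem η_samp (X : Det C) :
    val (X := X) ((distributionMonad d).η.app X) ≫ samp d X = 𝟙 X.obj :=
  (d X.obj).sharp_samp _

@[simp]
theorem η_samp_assoc (X : Det C) {Z : C} (h : X.obj ⟶ Z) :
    val (X := X) ((distributionMonad d).η.app X) ≫ samp d X ≫ h = h :=
  ((d X.obj).sharp_samp_assoc _ h).trans (Category.id_comp h)

@[simp]
theorem μ_samp (X : Det C) :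
    val (X := (distributionMonad d).obj ((distributionMonad d).obj X))
      ((distributionMonad d).μ.app X) ≫ samp d X =
      samp d ((distributionMonad d).obj X) ≫ samp d X :=
  (d X.obj).sharp_samp _

/-! ### The symmetric monoidal and affine structure of the monad. -/

/-- The morphism `∇` is determined by sampling independently from both factors. -/
noncomputable def nabla (X Y : Det C) :
    (distributionMonad d).obj X ⊗ (distributionMonad d).obj Y ⟶ (distributionMonad d).obj (X ⊗ Y) :=
  sharp d (X := X ⊗ Y) (samp d X ⊗ₘ samp d Y)

@[simp]
theorem nabla_samp (X Y : Det C) :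
    val (nabla d X Y) ≫ samp d (X ⊗ Y) = samp d X ⊗ₘ samp d Y :=
  sharp_samp d (X := X ⊗ Y) _

@[simp]
theorem nabla_samp_assoc (X Y : Det C) {Z : C} (h : X.obj ⊗ Y.obj ⟶ Z) :
    val (nabla d X Y) ≫ samp d (X ⊗ Y) ≫ h = (samp d X ⊗ₘ samp d Y) ≫ h :=
  sharp_samp_assoc d (X := X ⊗ Y) _ h

/-- After sampling, each axiom becomes interchange in `C` or naturality of a coherence isomorphism
of `C` with respect to `samp`. -/
noncomputable instance laxBraided : (distributionMonad d).toFunctor.LaxBraided where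
  ε := (distributionMonad d).η.app (𝟙_ (Det C))
  μ := nabla d
  μ_natural_left {X Y} f X' := hom_ext d (by
    simp only [val_comp, val_tensorHom, val_id, Category.assoc, nabla_samp, map_samp, nabla_samp_assoc,
      ← tensorHom_id, tensorHom_comp_tensorHom, Category.id_comp, Category.comp_id])
  μ_natural_right {X Y} X' f := hom_ext d (by
    simp only [val_comp, val_tensorHom, val_id, Category.assoc, nabla_samp, map_samp, nabla_samp_assoc,
      ← id_tensorHom, tensorHom_comp_tensorHom, Category.id_comp, Category.comp_id])
  associativity X Y Z := hom_ext d (by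
    simp only [val_comp, val_tensorHom, val_id, val_associator, Category.assoc,
      nabla_samp, map_samp, nabla_samp_assoc, ← id_tensorHom, ← tensorHom_id,
      tensorHom_comp_tensorHom, tensorHom_comp_tensorHom_assoc, Category.id_comp]
    exact associator_naturality _ _ _)
  left_unitality X := hom_ext d (by
    simp only [val_comp, val_tensorHom, val_id, val_leftUnitor, Category.assoc, map_samp,
      nabla_samp_assoc, ← tensorHom_id, tensorHom_comp_tensorHom_assoc, η_samp, Category.id_comp]
    exact (leftUnitor_naturality _).symm.trans (by rw [← id_tensorHom]; rfl))
  right_unitality X := hom_ext d (by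
    simp only [val_comp, val_tensorHom, val_id, val_rightUnitor, Category.assoc, map_samp,
      nabla_samp_assoc, ← id_tensorHom, tensorHom_comp_tensorHom_assoc, η_samp, Category.id_comp]
    exact (rightUnitor_naturality _).symm.trans (by rw [← tensorHom_id]; rfl))
  braided X Y := hom_ext d (by simp)

noncomputable instance symmetricMonoidal : (distributionMonad d).SymmetricMonoidal where
  laxBraided := laxBraided d
  isMonoidal_η :=
    { unit := Category.id_comp _
      tensor X Y := hom_ext d (by
        -- The lax structure of `𝟭` is the identity; unfolding it exposes `nabla` to the sampling
        -- lemmas.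
        change val (𝟙 (X ⊗ Y) ≫ (distributionMonad d).η.app (X ⊗ Y)) ≫ samp d (X ⊗ Y) =
          val ((_ ⊗ₘ _) ≫ nabla d X Y) ≫ _
        simp) }
  isMonoidal_μ :=
    -- After sampling, both sides are morphisms of `C` into the terminal object `𝟙_ C`.
    { unit := hom_ext d (Subsingleton.elim (α := _ ⟶ 𝟙_ C) _ _)
      tensor X Y := hom_ext d (by
        change val ((nabla d _ _ ≫ (distributionMonad d).map (nabla d X Y)) ≫
          (distributionMonad d).μ.app (X ⊗ Y)) ≫ samp d (X ⊗ Y) =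
          val ((_ ⊗ₘ _) ≫ nabla d X Y) ≫ _
        simp) }

instance affine : (distributionMonad d).Affine where
  nonempty_iso := ⟨{
    hom := toUnit _
    inv := (distributionMonad d).η.app (𝟙_ (Det C))
    hom_inv_id := hom_ext d (Subsingleton.elim (α := _ ⟶ 𝟙_ C) _ _)
    inv_hom_id := toUnit_unique _ _ }⟩

-- A morphism `f` into `P X` factors through `δ` exactly when `f ≫ samp` is deterministic, and a
-- cone over the square is forced to have the form `(f, (f, f))` with such an `f`.
open ComonObj in
theorem deltaPullback : (distributionMonad d).DeltaPullback := fun X => by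
  have key {T : Det C} (f : T ⟶ (distributionMonad d).obj X)
      (g : T ⟶ (distributionMonad d).obj X ⊗ (distributionMonad d).obj X)
      (h : f ≫ (distributionMonad d).map (lift (𝟙 X) (𝟙 X)) = g ≫ nabla d X X) :
      g = lift f f ∧ deterministic C (val f ≫ samp d X) := by
    obtain ⟨g₁, g₂, rfl⟩ : ∃ g₁ g₂, g = lift g₁ g₂ := ⟨g ≫ fst _ _, g ≫ snd _ _, by simp⟩
    -- The cone condition after sampling: copying the output of `f` is the same as sampling from
    -- `g₁` and `g₂` independently on a copied input.
    have h' : (val f ≫ samp d X) ≫ Δ[X.obj] =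
        Δ[T.obj] ≫ ((val g₁ ≫ samp d X) ⊗ₘ (val g₂ ≫ samp d X)) := by
      have := congrArg (fun k => val k ≫ samp d (X ⊗ X)) h
      simpa using this
    -- Discarding either output compares marginals: `f` and `g₁` have the same sampled morphism, and
    -- likewise `f` and `g₂`. Once all three coincide, `h'` is the definition of determinism.
    have h₁ := h' =≫ (X.obj ◁ ε[X.obj] ≫ (ρ_ X.obj).hom)
    have h₂ := h' =≫ (ε[X.obj] ▷ X.obj ≫ (λ_ X.obj).hom)
    rw [copy_fst] at h₁
    rw [copy_snd] at h₂
    simp only [Category.assoc, ComonObj.comul_counit_assoc, ComonObj.counit_comul_assoc,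
      Iso.inv_hom_id, Category.comp_id] at h₁ h₂
    obtain rfl := hom_ext d h₁
    obtain rfl := hom_ext d h₂
    exact ⟨rfl, (deterministic_iff _).2 h'⟩
  have hη {T : Det C} (f : T ⟶ (distributionMonad d).obj X)
      (hf : deterministic C (val f ≫ samp d X)) :
      ofVal (val f ≫ samp d X) hf ≫ (distributionMonad d).η.app X = f := hom_ext d (by simp)
  refine ⟨⟨hom_ext d (X := X ⊗ X) ?_⟩, ⟨Limits.PullbackCone.IsLimit.mk _
    (fun s => ofVal (val s.fst ≫ samp d X) (key s.fst s.snd s.condition).2)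
    (fun s => hη _ _) (fun s => ?_) (fun s m h₁ _ => ?_)⟩⟩
  · change val (_ ≫ (distributionMonad d).map (lift (𝟙 X) (𝟙 X))) ≫ samp d (X ⊗ X) =
      val (_ ≫ nabla d X X) ≫ _
    simp
  · refine (comp_lift _ _ _).trans ?_
    rw [hη]
    exact (key s.fst s.snd s.condition).1.symm
  -- Since `δ` followed by `samp` is the identity, sampling recovers `m` from its composite with
  -- `δ`.
  · refine val_injective ?_
    have h := congrArg (fun k => val k ≫ samp d X) h₁
    simpa using h

/-! ### The isomorphism of Markov categories between `C` and `Kl(P)`. -/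

/-- The comparison functor `C ⥤ Kl(P)`. -/
noncomputable def toKl : C ⥤ Kleisli (distributionMonad d) where
  obj X := .mk _ ⟨X⟩
  map {X Y} f := .mk (sharp d f)
  map_id X := rfl
  map_comp {X Y Z} f g := by
    ext1
    refine hom_ext d (X := ⟨Z⟩) ?_
    change val (sharp d (f ≫ g)) ≫ _ =
      val (sharp d f ≫ (distributionMonad d).map (sharp d g) ≫
        (distributionMonad d).μ.app ⟨Z⟩) ≫ samp d ⟨Z⟩
    simp

/-- Sampling defines the inverse `Kl(P) ⥤ C` of the comparison functor. -/
noncomputable def ofKl : Kleisli (distributionMonad d) ⥤ C where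
  obj X := X.of.obj
  map {X Y} f := val f.of ≫ samp d Y.of
  map_id X := η_samp d X.of
  map_comp {X Y Z} f g := by
    change val (f.of ≫ (distributionMonad d).map g.of ≫ (distributionMonad d).μ.app Z.of) ≫ _ = _
    simp

/-- The structure isomorphisms and copy maps of `C` are deterministic, and those of `Kl(P)` are
images under `toKleisli`; this lemma therefore matches them all at once. -/
theorem toKl_map_val {X Y : Det C} (f : X ⟶ Y) :
    (toKl d).map (val f) = (Kleisli.Adjunction.toKleisli (distributionMonad d)).map f := by
  ext1
  refine hom_ext d (X := Y) ?_
  change val (sharp d (val f)) ≫ _ = val (f ≫ (distributionMonad d).η.app Y) ≫ _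
  simp

/-- Both sides sample to `f ⊗ g`, because `∇` samples its two factors independently. -/
theorem toKl_map_tensorHom {X Y X' Y' : C} (f : X ⟶ Y) (g : X' ⟶ Y') :
    (toKl d).map f ⊗ₘ (toKl d).map g = (toKl d).map (f ⊗ₘ g) := by
  ext1
  refine hom_ext d (X := ⟨Y⟩ ⊗ ⟨Y'⟩) ?_
  change val ((sharp d f ⊗ₘ sharp d g) ≫ nabla d ⟨Y⟩ ⟨Y'⟩) ≫ _ =
    val (sharp d (A := ⟨X⟩ ⊗ ⟨X'⟩) (X := ⟨Y⟩ ⊗ ⟨Y'⟩) (f ⊗ₘ g)) ≫ _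
  simp

theorem toKl_map_whiskerRight {X Y : C} (f : X ⟶ Y) (Z : C) :
    (toKl d).map f ▷ (toKl d).obj Z = (toKl d).map (f ▷ Z) := by
  rw [← tensorHom_id, ← tensorHom_id, ← toKl_map_tensorHom, Functor.map_id]

theorem toKl_map_whiskerLeft (Z : C) {X Y : C} (f : X ⟶ Y) :
    (toKl d).obj Z ◁ (toKl d).map f = (toKl d).map (Z ◁ f) := by
  rw [← id_tensorHom, ← id_tensorHom, ← toKl_map_tensorHom, Functor.map_id]

/-- The comparison functor is strict monoidal. -/
noncomputable def toKlCoreMonoidal : (toKl d).CoreMonoidal where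
  εIso := Iso.refl ((toKl d).obj (𝟙_ C))
  μIso X Y := Iso.refl ((toKl d).obj (X ⊗ Y))
  μIso_hom_natural_left f Z :=
    (Category.comp_id _).trans ((toKl_map_whiskerRight d f Z).trans (Category.id_comp _).symm)
  μIso_hom_natural_right Z f :=
    (Category.comp_id _).trans ((toKl_map_whiskerLeft d Z f).trans (Category.id_comp _).symm)
  associativity X Y Z := by
    -- All coherence maps are identities, whose sources and targets match only up to unfolding; they
    -- are removed by explicit `.trans`, leaving the associator alone.
    have h₁ : 𝟙 ((toKl d).obj (X ⊗ Y)) ▷ (toKl d).obj Z = 𝟙 ((toKl d).obj ((X ⊗ Y) ⊗ Z)) :=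
      id_whiskerRight _ _
    have h₂ : (toKl d).obj X ◁ 𝟙 ((toKl d).obj (Y ⊗ Z)) = 𝟙 ((toKl d).obj (X ⊗ Y ⊗ Z)) :=
      whiskerLeft_id _ _
    refine (h₁ =≫ _).trans (.trans ?_ (_ ≫= (h₂ =≫ _)).symm)
    refine (Category.id_comp _).trans ((Category.id_comp _).trans ?_)
    refine .trans ?_ (_ ≫= (Category.id_comp _).symm)
    refine .trans ?_ (Category.comp_id _).symm
    exact toKl_map_val d (α_ (⟨X⟩ : Det C) ⟨Y⟩ ⟨Z⟩).hom
  left_unitality X := by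
    have h : 𝟙 ((toKl d).obj (𝟙_ C)) ▷ (toKl d).obj X = 𝟙 ((toKl d).obj (𝟙_ C ⊗ X)) :=
      id_whiskerRight _ _
    refine .trans ?_ (h =≫ _).symm
    refine .trans ?_ ((Category.id_comp _).trans (Category.id_comp _)).symm
    exact (toKl_map_val d (λ_ (⟨X⟩ : Det C)).hom).symm
  right_unitality X := by
    have h : (toKl d).obj X ◁ 𝟙 ((toKl d).obj (𝟙_ C)) = 𝟙 ((toKl d).obj (X ⊗ 𝟙_ C)) :=
      whiskerLeft_id _ _
    refine .trans ?_ (h =≫ _).symm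
    refine .trans ?_ ((Category.id_comp _).trans (Category.id_comp _)).symm
    exact (toKl_map_val d (ρ_ (⟨X⟩ : Det C)).hom).symm

noncomputable instance toKlBraided : (toKl d).Braided where
  __ := (toKlCoreMonoidal d).toMonoidal
  braided X Y := by
    refine (Category.id_comp _).trans (.trans ?_ (Category.comp_id _).symm)
    exact toKl_map_val d (β_ (⟨X⟩ : Det C) ⟨Y⟩).hom

open ComonObj in
/-- The comparison functor as an isomorphism of Markov categories `C ≅ Kl(P)`. -/
noncomputable def markovIso : MarkovIso C (Kleisli (distributionMonad d)) where
  functor := toKl d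
  inverse := ofKl d
  functor_inverse := Functor.ext (fun _ => rfl) fun X Y f => by
    -- The functors agree on objects by `rfl`, so the `eqToHom` factors in `Functor.ext` are
    -- identities.
    refine .trans ?_ ((Category.id_comp _).trans (Category.comp_id _)).symm
    exact sharp_samp d (A := ⟨X⟩) (X := ⟨Y⟩) f
  inverse_functor := Functor.ext (fun _ => rfl) fun X Y f => by
    refine .trans ?_ ((Category.id_comp _).trans (Category.comp_id _)).symm
    exact Kleisli.hom_ext (sharp_eq d f.of)
  braided := toKlBraided d
  obj_unit := rfl
  obj_tensor _ _ := rfl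
  ε_eq := rfl
  μ_eq _ _ := rfl
  map_copy X := by
    refine .trans ?_ (Category.comp_id _).symm
    refine (toKl_map_val d (⟨Δ[X], deterministic_copy X⟩ : (⟨X⟩ : Det C) ⟶ ⟨X⟩ ⊗ ⟨X⟩)).trans ?_
    refine congrArg (Kleisli.Adjunction.toKleisli (distributionMonad d)).map ?_
    ext
    -- The diagonal of `C_det` is a pairing of identities, which is defined by copying.
    change Δ[X] = Δ[X] ≫ (𝟙 X ⊗ₘ 𝟙 X)
    simp

theorem incl_comp_toKl :
    Det.incl C ⋙ toKl d = Kleisli.Adjunction.toKleisli (distributionMonad d) :=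
  Functor.ext (fun _ => rfl) fun X Y f => by
    refine .trans ?_ ((Category.id_comp _).trans (Category.comp_id _)).symm
    exact toKl_map_val d f

end distributionMonad

/-! ### Distribution objects from a Kleisli presentation. -/

/-- If `C` is equivalent to `Kl(P)` relative to `C_det`, then `P X` is a distribution object for
`X`: sampling corresponds to the Kleisli morphism represented by the identity of `P X`. -/
theorem isRepresentable_of_toKleisli_comp_iso (P : Monad (Det C)) (G : Kleisli P ⥤ C)
    (hG : G.FullyFaithful) (i : Kleisli.Adjunction.toKleisli P ⋙ G ≅ Det.incl C) :
    IsRepresentable C := fun X => by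
  let s : (Kleisli.Adjunction.toKleisli P).obj (P.obj ⟨X⟩) ⟶
    (Kleisli.Adjunction.toKleisli P).obj ⟨X⟩ := .mk (𝟙 _)
  -- Naturality of `i.inv` turns composition with the sampling map in `C` into composition with `s`
  -- in `Kl(P)`.
  have hs {A : Det C} (f : A ⟶ P.obj ⟨X⟩) : (Det.incl C).map f ≫ i.inv.app (P.obj ⟨X⟩) ≫
      G.map s ≫ i.hom.app ⟨X⟩ = i.inv.app A ≫
        G.map ((Kleisli.Adjunction.toKleisli P).map f ≫ s) ≫ i.hom.app ⟨X⟩ := by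
    rw [i.inv.naturality_assoc, G.map_comp, Category.assoc]
    rfl
  have hf {A : Det C} (f : A ⟶ P.obj ⟨X⟩) :
      ((Kleisli.Adjunction.toKleisli P).map f ≫ s).of = f :=
    (Kleisli.toKleisli_comp_of f s).trans (Category.comp_id f)
  refine ⟨⟨(P.obj ⟨X⟩).obj, i.inv.app (P.obj ⟨X⟩) ≫ G.map s ≫ i.hom.app ⟨X⟩, fun A =>
    ⟨fun f g hfg => ?_, fun (k : (Det.incl C).obj A ⟶ (Det.incl C).obj ⟨X⟩) => ?_⟩⟩⟩
  -- Injectivity: the components of `i` cancel, `G` is faithful, and `toKleisli f ≫ s` is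
  -- represented by `f` itself.
  · have h := (hs f).symm.trans (hfg.trans (hs g))
    rw [cancel_epi, cancel_mono] at h
    exact (hf f).symm.trans ((congrArg Kleisli.Hom.of (hG.map_injective h)).trans (hf g))
  -- Surjectivity: `k` is conjugated by `i` and lifted along the full functor `G`; the
  -- representative of the lift is the required map `A ⟶ P X` of `C_det`.
  · let k' : (Kleisli.Adjunction.toKleisli P).obj A ⟶ (Kleisli.Adjunction.toKleisli P).obj ⟨X⟩ :=
      hG.preimage (i.hom.app A ≫ k ≫ i.inv.app ⟨X⟩)
    let f : A ⟶ P.obj ⟨X⟩ := k'.of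
    have hk : G.map ((Kleisli.Adjunction.toKleisli P).map f ≫ s) =
        i.hom.app A ≫ k ≫ i.inv.app ⟨X⟩ :=
      (congrArg G.map (Kleisli.hom_ext (hf f))).trans (hG.map_preimage _)
    refine ⟨f, (hs f).trans ?_⟩
    rw [hk, Category.assoc, Category.assoc, i.inv_hom_id_app_assoc, i.inv_hom_id_app,
      Category.comp_id]

end Representable

end CategoryTheory

open CategoryTheory
theorem theorem3p11 (C : Type u) [Category.{v} C] [MonoidalCategory C] [MarkovCategory C] :
    IsRepresentable C ↔
      ∃ (P : Monad (Det C)) (_ : P.SymmetricMonoidal) (_ : P.Affine),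
        P.DeltaPullback ∧
        ∃ Φ : MarkovIso C (Kleisli P),
          Det.incl C ⋙ Φ.functor = Kleisli.Adjunction.toKleisli P := by
  constructor
  · intro h
    let d (X : C) : DistributionObject X := (h X).some
    exact ⟨distributionMonad d, distributionMonad.symmetricMonoidal d, distributionMonad.affine d,
      distributionMonad.deltaPullback d, distributionMonad.markovIso d,
      distributionMonad.incl_comp_toKl d⟩
  · rintro ⟨P, _, _, -, Φ, hΦ⟩
    -- Viewing `Φ` as an equivalence makes `Φ.inverse` fully faithful; composing `hΦ` with
    -- `Φ.inverse` identifies `toKleisli P ⋙ Φ.inverse` with the inclusion.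
    let e : Kleisli P ≌ C := .mk Φ.inverse Φ.functor (eqToIso Φ.inverse_functor.symm)
      (eqToIso Φ.functor_inverse)
    refine isRepresentable_of_toKleisli_comp_iso P Φ.inverse e.fullyFaithfulFunctor (eqToIso ?_)
    rw [← hΦ, Functor.assoc, Φ.functor_inverse, Functor.comp_id]
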